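/- Let $\Sigma=\{0,1\}$. Call a set $A\subseteq\Sigma^*$ coRE if its complement $\Sigma^*\setminus A$ is recursively enumerable, and coRE-complete if $A$ is coRE and every coRE set $B\subseteq\Sigma^*$ many-one reduces to $A$, i.e. there is a total recursive function $g:\Sigma^*\to\Sigma^*$ such that for all $x\in\Sigma^*$, $x\in B\iff g(x)\in A$. Let $\mathrm{F}_{\mathrm{REC}}$ be the class of total recursive functions from $\Sigma^*$ to $\Sigma^*$. A set $A\subseteq\Sigma^*$ is $\mathrm{F}_{\mathrm{REC}}$-compressible if there is $f\in\mathrm{F}_{\mathrm{REC}}$ with $f(A)=\Sigma^*$ and $f(a)\neq f(b)$ for all distinct $a,b\in A$. Then every coRE-complete set $A\subseteq\Sigma^*$ is $\mathrm{F}_{\mathrm{REC}}$-compressible. -/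

import Mathlib

namespace RecCompress

/-- Strings over the alphabet `{0, 1}`. -/
abbrev Str : Type := List Bool

/-- The class `F_REC` of total recursive functions on strings, as a class of (possibly partial)
functions. -/
def FREC : Set (Str →. Str) := {f | ∃ g : Str → Str, Computable g ∧ f = (g : Str →. Str)}

/-- `A` is co-r.e.: its complement is recursively enumerable. -/
def IsCoRE (A : Set Str) : Prop := REPred fun x : Str => x ∈ Aᶜ

/-- `A` is coRE-complete with respect to recursive many-one reductions. -/
def IsCoREComplete (A : Set Str) : Prop :=
  IsCoRE A ∧ ∀ B : Set Str, IsCoRE B →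
    ManyOneReducible (fun x : Str => x ∈ B) (fun x : Str => x ∈ A)

/-- The (possibly partial) function `f` is a compression function for `A`: it is defined on `A`,
maps `A` onto the set of all strings, and is injective on `A`. -/
def IsCompressionFunction (f : Str →. Str) (A : Set Str) : Prop :=
  A ⊆ f.Dom ∧ f.image A = Set.univ ∧ ∀ a ∈ A, ∀ b ∈ A, a ≠ b → f a ≠ f b

/-- `A` is `F`-compressible: some function in the class `F` is a compression function for `A`. -/
def IsCompressible (F : Set (Str →. Str)) (A : Set Str) : Prop :=
  ∃ f ∈ F, IsCompressionFunction f A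

end RecCompress

/-!
Suppose a computable bijection `e` from strings to pairs of a string and a number carries `A` onto a
set `E` that contains exactly one pair `(x, k)` for each string `x`. Then the first component of `e`
is a compression function for `A`.

Such an `E` comes from `A` itself (`ExitTime`). Fix an enumeration of the complement of `A` in
stages, and let `E` hold the pairs `(x, 0)` with `x` never enumerated, that is `x ∈ A`, and the
pairs `(x, s + 1)` with `x` enumerated exactly at stage `s + 1`. The set `E` is again coRE, and it
has one point over each `x`: an `x` that is never enumerated gives only `(x, 0)`, any other only its
own exit stage.

The bijection `e` comes from Myhill's isomorphism theorem. It is proved here from reductions in both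
directions whose values can be kept out of a given finite set (`AvoidReducible`). Given these, the
usual back-and-forth construction produces a computable bijection, the next partner being simply a
fresh equivalent instance (`exists_computable_bijective`). The reduction of `A` to `E` is
`x ↦ (x', 0)` with `x'` a fresh string equivalent to `x`. So both reductions come from one padding
property of `A`: every r.e. predicate reduces to the complement of `A` with values outside any given
finite list (`avoidReducible_of_halting`). The padding property follows from many-one completeness
by the recursion theorem (`exists_pad`).
-/

open Nat.Partrec Encodable

namespace RecCompress

variable {α β γ : Type*}

/-! ### Finite partial bijections -/

/-- `L` is the graph of a finite partial bijection that respects `P` and `Q`. -/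
def IsPartialMatch (P : α → Prop) (Q : β → Prop) (L : List (α × β)) : Prop :=
  (∀ p ∈ L, P p.1 ↔ Q p.2) ∧ ∀ p ∈ L, ∀ q ∈ L, p.1 = q.1 ↔ p.2 = q.2

theorem IsPartialMatch.swap {P : α → Prop} {Q : β → Prop} {L : List (α × β)}
    (h : IsPartialMatch P Q L) : IsPartialMatch Q P (L.map Prod.swap) := by
  constructor
  · intro p hp
    obtain ⟨p', hp', rfl⟩ := List.mem_map.1 hp
    exact (h.1 p' hp').symm
  · intro p hp q hq
    obtain ⟨p', hp', rfl⟩ := List.mem_map.1 hp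
    obtain ⟨q', hq', rfl⟩ := List.mem_map.1 hq
    exact (h.2 p' hp' q' hq').symm

section Extend

variable [DecidableEq α]

/-- Put `a` into the domain of the finite partial bijection `L`, unless it is there already,
using `v` to choose a partner not yet used. -/
def extend (v : α → List β → β) (a : α) (L : List (α × β)) : List (α × β) :=
  bif decide (a ∈ L.map Prod.fst) then L else (a, v a (L.map Prod.snd)) :: L

theorem subset_extend (v : α → List β → β) (a : α) (L : List (α × β)) : L ⊆ extend v a L := by
  unfold extend
  cases decide (a ∈ L.map Prod.fst)
  · exact List.subset_cons_self _ _
  · exact List.Subset.refl _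

theorem exists_mem_extend (v : α → List β → β) (a : α) (L : List (α × β)) :
    ∃ b, (a, b) ∈ extend v a L := by
  unfold extend
  by_cases h : a ∈ L.map Prod.fst
  · obtain ⟨⟨a', b⟩, hb, rfl⟩ := List.mem_map.1 h
    exact ⟨b, by simpa only [h, decide_true, cond_true] using hb⟩
  · exact ⟨v a (L.map Prod.snd), by simp [h]⟩

theorem IsPartialMatch.extend {P : α → Prop} {Q : β → Prop} {L : List (α × β)}
    (h : IsPartialMatch P Q L) {v : α → List β → β}
    (hv : ∀ a l, v a l ∉ l ∧ (P a ↔ Q (v a l))) (a : α) :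
    IsPartialMatch P Q (extend v a L) := by
  unfold RecCompress.extend
  by_cases ha : a ∈ L.map Prod.fst
  · simpa only [ha, decide_true, cond_true] using h
  · simp only [ha, decide_false, cond_false]
    obtain ⟨hn, he⟩ := hv a (L.map Prod.snd)
    have ha' : ∀ p ∈ L, p.1 ≠ a := fun p hp e => ha (e ▸ List.mem_map_of_mem hp)
    have hb' : ∀ p ∈ L, p.2 ≠ v a (L.map Prod.snd) := fun p hp e =>
      hn (e ▸ List.mem_map_of_mem hp)
    constructor
    · intro p hp
      rcases List.mem_cons.1 hp with rfl | hp
      · exact he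
      · exact h.1 p hp
    · intro p hp q hq
      rcases List.mem_cons.1 hp with rfl | hp <;> rcases List.mem_cons.1 hq with rfl | hq
      · simp
      · exact iff_of_false (ha' q hq).symm (hb' q hq).symm
      · exact iff_of_false (ha' p hp) (hb' p hp)
      · exact h.2 p hp q hq

end Extend

/-! ### The set of exit times -/

/-- For a stage function `t` enumerating the complement of a set, the pairs `(x, 0)` with `x` never
enumerated and the pairs `(x, s + 1)` with `x` enumerated exactly at stage `s + 1`.
If `t x` is monotone and starts with `false`, then exactly one pair with first component `x`
belongs. -/
def ExitTime (t : α → ℕ → Bool) : α × ℕ → Prop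
  | (x, 0) => ∀ n, t x n = false
  | (x, s + 1) => t x (s + 1) = true ∧ t x s = false

theorem exists_exitTime {t : α → ℕ → Bool} (h0 : ∀ a, t a 0 = false) (x : α) :
    ∃ k, ExitTime t (x, k) := by
  classical
  by_cases h : ∃ n, t x n = true
  · have hs := Nat.find_spec h
    have hm := fun m => Nat.find_min h (m := m)
    rcases hk : Nat.find h with _ | s
    · simp [hk, h0] at hs
    · rw [hk] at hs hm
      exact ⟨s + 1, hs, by simpa using hm s (Nat.lt_succ_self s)⟩
  · exact ⟨0, fun n => by simpa using fun hn => h ⟨n, hn⟩⟩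

theorem ExitTime.unique {t : α → ℕ → Bool} (hmono : ∀ a, Monotone (t a)) {x : α} {j k : ℕ}
    (hj : ExitTime t (x, j)) (hk : ExitTime t (x, k)) : j = k := by
  -- Monotonicity between two exit stages `i + 1 < j + 1`.
  have key : ∀ {i j : ℕ}, i < j → t x (i + 1) = true → t x j = false → False := by
    intro i j hij h1 h2
    have := hmono x (Nat.succ_le_of_lt hij)
    rw [Nat.succ_eq_add_one, h1, h2] at this
    exact absurd this (by decide)
  rcases j with _ | j <;> rcases k with _ | k
  · rfl
  · have := hj (k + 1)
    simp [hk.1] at this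
  · have := hk (j + 1)
    simp [hj.1] at this
  · rcases lt_trichotomy j k with h | h | h
    · exact (key h hj.1 hk.2).elim
    · rw [h]
    · exact (key h hk.1 hj.2).elim

/-! ### Computability preliminaries -/

variable [Primcodable α] [Primcodable β] [Primcodable γ]

theorem primrec₂_decide_mem [DecidableEq α] :
    Primrec₂ fun (a : α) (l : List α) => decide (a ∈ l) := by
  have h : PrimrecRel fun (a : α) (l : List α) => l.idxOf a < l.length :=
    Primrec.nat_lt.comp (Primrec.list_idxOf.comp Primrec.fst Primrec.snd)
      (Primrec.list_length.comp Primrec.snd)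
  refine h.decide.of_eq fun a l => ?_
  simp [List.idxOf_lt_length_iff]

theorem primrec_map_fst : Primrec fun l : List (α × β) => l.map Prod.fst :=
  Primrec.list_map Primrec.id (Primrec.fst.comp₂ Primrec₂.right)

theorem primrec_map_snd : Primrec fun l : List (α × β) => l.map Prod.snd :=
  Primrec.list_map Primrec.id (Primrec.snd.comp₂ Primrec₂.right)

theorem primrec_map_swap : Primrec fun l : List (α × β) => l.map Prod.swap :=
  Primrec.list_map Primrec.id
    ((Primrec.pair Primrec.snd Primrec.fst).comp₂ Primrec₂.right)

/-- The enumeration of an r.e. predicate in stages: `t a k` says that `a` has been found within `k`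
steps. -/
theorem exists_stages_of_rePred {P : α → Prop} (hP : REPred P) :
    ∃ t : α → ℕ → Bool, Computable₂ t ∧ (∀ a, t a 0 = false) ∧
      (∀ a, Monotone (t a)) ∧ ∀ a, P a ↔ ∃ k, t a k = true := by
  obtain ⟨c, hc⟩ := Code.exists_code.1 hP
  refine ⟨fun a k => (Code.evaln k c (encode a)).isSome, ?_, ?_, ?_, ?_⟩
  · exact (Primrec.option_isSome.comp (Code.primrec_evaln.comp
      ((Primrec.snd.pair (Primrec.const c)).pair
        (Primrec.encode.comp Primrec.fst)))).to_comp
  · intro a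
    simp [Code.evaln]
  · intro a k₁ k₂ hk h
    obtain ⟨x, hx⟩ := Option.isSome_iff_exists.1 h
    exact Option.isSome_iff_exists.2 ⟨x, Code.evaln_mono hk hx⟩
  · intro a
    have hdom : P a ↔ (Code.eval c (encode a)).Dom := by
      rw [hc]
      simp [Part.assert]
    rw [hdom, Part.dom_iff_mem]
    simp only [Code.evaln_complete, Option.isSome_iff_exists, Option.mem_def]
    exact exists_comm

theorem rePred_exists {T : α → ℕ → Bool} (hT : Computable₂ T) :
    REPred fun a => ∃ n, T a n = true := by
  refine (Partrec.rfind hT.partrec₂).dom_re.of_eq fun a => ?_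
  rw [Nat.rfind_dom]
  constructor
  · rintro ⟨n, hn, _⟩
    exact ⟨n, by simpa using hn⟩
  · rintro ⟨n, hn⟩
    exact ⟨n, by simpa using hn, fun _ => trivial⟩

/-! ### Padding -/

/-- `AvoidReducible P Q` says that a computable function sends an instance `a` of `P` and a finite
list `l` to an equivalent instance of `Q` outside `l`. -/
def AvoidReducible (P : α → Prop) (Q : β → Prop) : Prop :=
  ∃ v : α → List β → β, Computable₂ v ∧ ∀ a l, v a l ∉ l ∧ (P a ↔ Q (v a l))

/-- If the halting problem reduces to `C`, then from `x` and a finite list `D` of instances of `C`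
all equivalent to `P x`, one can compute one more equivalent instance outside `D`.

By the recursion theorem there are programs, for `b = false` and `b = true`, that know their own value
`y` under the reduction. If `y ∉ D`, such a program semi-decides `P x`, so that `C y ↔ P x`. If
`y ∈ D`, it diverges for `b = false` and halts for `b = true`, so that `D` contains a non-member or a
member of `C`, respectively. As all of `D` agrees on `C`, at least one of the two values is outside
`D`. -/
theorem exists_pad [DecidableEq γ] {P : α → Prop} {C : γ → Prop} (hP : REPred P) {h : Code → γ}
    (hc : Computable h) (hC : ∀ c, (Code.eval c 0).Dom ↔ C (h c)) :
    ∃ pad : α → List γ → γ, Computable₂ pad ∧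
      ∀ x D, (∀ d ∈ D, C d ↔ P x) → pad x D ∉ D ∧ (C (pad x D) ↔ P x) := by
  -- `R c` is the behaviour described above, when the values are computed from the program `c`;
  -- the parameters `x`, `D`, `b` are passed to `c` by currying.
  let R : Code → (α × List γ) × Bool →. ℕ := fun c z =>
    bif decide (h (Code.curry c (encode z)) ∈ z.1.2) then
      (bif z.2 then Part.some 0 else Part.none)
    else (Part.assert (P z.1.1) fun _ => Part.some ()).map fun _ => 0
  have hmem : Computable fun p : Code × ((α × List γ) × Bool) =>
      decide (h (Code.curry p.1 (encode p.2)) ∈ p.2.1.2) :=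
    primrec₂_decide_mem.to_comp.comp
      (hc.comp (Code.primrec₂_curry.to_comp.comp Computable.fst
        (Computable.encode.comp Computable.snd)))
      (Computable.snd.comp (Computable.fst.comp Computable.snd))
  have hR : Partrec₂ R := by
    refine Partrec.cond hmem ?_ ?_
    · exact Partrec.cond (Computable.snd.comp Computable.snd)
        (Computable.const 0).partrec Partrec.none
    · exact Partrec.map (Partrec.comp hP
        (Computable.fst.comp (Computable.fst.comp Computable.snd)))
        (Computable.const 0).to₂
  have hf : Partrec₂ fun (c : Code) (m : ℕ) =>
      ((decode m.unpair.1 : Option ((α × List γ) × Bool)) : Part _).bind (R c) := by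
    refine Partrec.bind (Computable.ofOption (Computable.decode.comp
      (Computable.fst.comp (Computable.unpair.comp Computable.snd)))) ?_
    exact hR.comp₂ (Computable.fst.comp Computable.fst).to₂ Computable.snd.to₂
  obtain ⟨c, hcf⟩ := Code.fixed_point₂ hf
  let y : α → List γ → Bool → γ := fun x D b => h (Code.curry c (encode ((x, D), b)))
  have hy : ∀ x D b, C (y x D b) ↔ (y x D b ∈ D ∧ b = true) ∨ (y x D b ∉ D ∧ P x) := by
    intro x D b
    have heval : Code.eval (Code.curry c (encode ((x, D), b))) 0 = R c ((x, D), b) := by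
      rw [Code.eval_curry, hcf]
      simp only [Nat.unpair_pair, encodek, Part.coe_some]
      exact Part.bind_some _ _
    rw [← hC, heval]
    change (bif decide (y x D b ∈ D) then (bif b then Part.some 0 else Part.none)
      else (Part.assert (P x) fun _ => Part.some ()).map fun _ => 0 : Part ℕ).Dom ↔ _
    by_cases hm : y x D b ∈ D
    · cases b <;> simp [hm]
    · simp [hm, Part.assert]
  have hyc : ∀ b, Computable fun p : α × List γ => y p.1 p.2 b := fun b =>
    hc.comp (Code.primrec₂_curry.to_comp.comp (Computable.const c)
      (Computable.encode.comp (Computable.id.pair (Computable.const b))))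
  refine ⟨fun x D => bif decide (y x D false ∈ D) then y x D true else y x D false, ?_, ?_⟩
  · exact Computable.cond (primrec₂_decide_mem.to_comp.comp (hyc false) Computable.snd)
      (hyc true) (hyc false)
  · intro x D hD
    have h0 := hy x D false
    have h1 := hy x D true
    by_cases m0 : y x D false ∈ D
    · have e0 := hD _ m0
      by_cases m1 : y x D true ∈ D
      · have e1 := hD _ m1
        simp_all
      · simp_all
    · simp_all

/-- If the halting problem reduces to `C`, then every r.e. predicate reduces to `C` with values
outside any given finite list. -/
theorem avoidReducible_of_halting [DecidableEq γ] {P : α → Prop} {C : γ → Prop} (hP : REPred P)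
    {h : Code → γ} (hc : Computable h) (hC : ∀ c, (Code.eval c 0).Dom ↔ C (h c)) :
    AvoidReducible P C := by
  obtain ⟨pad, hpad, hp⟩ := exists_pad hP hc hC
  -- `exists_pad` needs a list of equivalent instances, which the list to be avoided need not be.
  -- Iterating it from `[]` keeps that hypothesis and gives infinitely many equivalent instances,
  -- the first of which outside the list to be avoided is chosen.
  let S : α → ℕ → List γ := fun x n => Nat.rec [] (fun _ D => pad x D :: D) n
  have hS : Computable₂ S := by
    have hD : Computable fun p : (α × ℕ) × ℕ × List γ => p.2.2 :=
      Computable.snd.comp Computable.snd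
    have hcons : Computable₂ fun (p : α × ℕ) (z : ℕ × List γ) => pad p.1 z.2 :: z.2 :=
      Computable.list_cons.comp (hpad.comp (Computable.fst.comp Computable.fst) hD) hD
    exact Computable.nat_rec Computable.snd (Computable.const []) hcons
  have hS_hom : ∀ x n, ∀ d ∈ S x n, C d ↔ P x := by
    intro x n
    induction n with
    | zero => intro d hd; cases hd
    | succ n ih =>
      intro d hd
      rcases List.mem_cons.1 hd with rfl | hd
      · exact (hp x _ ih).2
      · exact ih d hd
  have hsub : ∀ x, Monotone fun n => (S x n).toFinset := by
    intro x
    refine monotone_nat_of_le_succ fun n d hd => ?_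
    exact List.mem_toFinset.2 (List.mem_cons_of_mem _ (List.mem_toFinset.1 hd))
  let q : α → ℕ → γ := fun x n => pad x (S x n)
  have hq : Computable₂ q := hpad.comp Computable.fst hS
  have hq_inj : ∀ x, Function.Injective (q x) := by
    intro x
    refine Function.Injective.of_lt_imp_ne fun m n hmn he => ?_
    refine (hp x _ (hS_hom x n)).1 ?_
    change q x n ∈ S x n
    rw [← he]
    exact List.mem_toFinset.1 (hsub x (Nat.succ_le_of_lt hmn)
      (List.mem_toFinset.2 List.mem_cons_self))
  have hex : ∀ x (l : List γ), ∃ n, q x n ∉ l := by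
    intro x l
    obtain ⟨n, hn⟩ := Infinite.exists_notMem_finset
      (l.toFinset.preimage (q x) (hq_inj x).injOn)
    exact ⟨n, by simpa using hn⟩
  let N : α → List γ → ℕ := fun x l => Nat.find (hex x l)
  have hN : Computable₂ N := by
    have hpred : Computable₂ fun (p : α × List γ) (n : ℕ) => !decide (q p.1 n ∈ p.2) :=
      Primrec.not.to_comp.comp (primrec₂_decide_mem.to_comp.comp
        (hq.comp (Computable.fst.comp Computable.fst) Computable.snd)
        (Computable.snd.comp Computable.fst))
    refine (Partrec.rfind hpred.partrec₂).of_eq_tot fun p => ?_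
    refine Nat.mem_rfind.2 ⟨?_, fun {m} hm => ?_⟩
    · simpa using Nat.find_spec (hex p.1 p.2)
    · simpa using Nat.find_min (hex p.1 p.2) hm
  refine ⟨fun x l => q x (N x l), hq.comp Computable.fst hN, fun x l => ⟨?_, ?_⟩⟩
  · exact Nat.find_spec (hex x l)
  · exact (hp x _ (hS_hom x _)).2.symm

/-! ### Back and forth -/

section BackAndForth

theorem computable_extend [DecidableEq α] {v : α → List β → β} (hv : Computable₂ v) :
    Computable₂ (extend v) := by
  refine Computable.cond (primrec₂_decide_mem.to_comp.comp Computable.fst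
    (primrec_map_fst.to_comp.comp Computable.snd)) Computable.snd ?_
  exact Computable.list_cons.comp (Computable.fst.pair
    (hv.comp Computable.fst (primrec_map_snd.to_comp.comp Computable.snd))) Computable.snd

variable [DecidableEq α] [DecidableEq β]

/-- One round of the back-and-forth construction: treat the `k`-th element of `α`, then the `k`-th
element of `β`. -/
def round (v : α → List β → β) (w : β → List α → α) (k : ℕ) (L : List (α × β)) :
    List (α × β) :=
  let L' := (decode k : Option α).elim L fun a => extend v a L
  (decode k : Option β).elim L' fun b => (extend w b (L'.map Prod.swap)).map Prod.swap

theorem computable_round {v : α → List β → β} {w : β → List α → α}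
    (hv : Computable₂ v) (hw : Computable₂ w) : Computable₂ (round v w) := by
  have h₁ : Computable fun p : ℕ × List (α × β) =>
      (decode p.1 : Option α).elim p.2 fun a => extend v a p.2 := by
    refine (Computable.option_casesOn (Computable.decode.comp Computable.fst) Computable.snd
      ((computable_extend hv).comp₂ Computable.snd.to₂
        (Computable.snd.comp Computable.fst).to₂)).of_eq fun p => ?_
    cases (decode p.1 : Option α) <;> rfl
  have h₂ : Computable₂ fun (p : ℕ × List (α × β)) (b : β) =>
      (extend w b (((decode p.1 : Option α).elim p.2 fun a => extend v a p.2).map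
        Prod.swap)).map Prod.swap :=
    primrec_map_swap.to_comp.comp ((computable_extend hw).comp Computable.snd
      (primrec_map_swap.to_comp.comp (h₁.comp Computable.fst)))
  refine (Computable.option_casesOn (Computable.decode.comp Computable.fst) h₁ h₂).of_eq
    fun p => ?_
  simp only [round]
  cases (decode p.1 : Option β) <;> rfl

theorem subset_round (v : α → List β → β) (w : β → List α → α) (k : ℕ) (L : List (α × β)) :
    L ⊆ round v w k L := by
  have hswap : ∀ (b : β) (M : List (α × β)),
      M ⊆ (extend w b (M.map Prod.swap)).map Prod.swap := fun b M p hp =>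
    List.mem_map.2 ⟨p.swap, subset_extend w b _ (List.mem_map_of_mem hp), Prod.swap_swap p⟩
  unfold round
  rcases (decode k : Option α) with _ | a <;> rcases (decode k : Option β) with _ | b
  · exact List.Subset.refl _
  · exact hswap b L
  · exact subset_extend v a L
  · exact List.Subset.trans (subset_extend v a L) (hswap b _)

theorem exists_mem_round_left (v : α → List β → β) (w : β → List α → α) (a : α)
    (L : List (α × β)) : ∃ b, (a, b) ∈ round v w (encode a) L := by
  obtain ⟨b, hb⟩ := exists_mem_extend v a L
  refine ⟨b, ?_⟩
  simp only [round, encodek, Option.elim_some]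
  rcases (decode (encode a) : Option β) with _ | b'
  · exact hb
  · exact List.mem_map.2 ⟨(b, a), subset_extend w b' _ (List.mem_map.2 ⟨_, hb, rfl⟩), rfl⟩

theorem exists_mem_round_right (v : α → List β → β) (w : β → List α → α) (b : β)
    (L : List (α × β)) : ∃ a, (a, b) ∈ round v w (encode b) L := by
  simp only [round, encodek, Option.elim_some]
  obtain ⟨a, ha⟩ := exists_mem_extend w b
    (((decode (encode b) : Option α).elim L fun a => extend v a L).map Prod.swap)
  exact ⟨a, List.mem_map.2 ⟨_, ha, rfl⟩⟩

theorem IsPartialMatch.round {P : α → Prop} {Q : β → Prop} {L : List (α × β)}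
    (h : IsPartialMatch P Q L) {v : α → List β → β} {w : β → List α → α}
    (hv : ∀ a l, v a l ∉ l ∧ (P a ↔ Q (v a l)))
    (hw : ∀ b l, w b l ∉ l ∧ (Q b ↔ P (w b l))) (k : ℕ) :
    IsPartialMatch P Q (round v w k L) := by
  unfold RecCompress.round
  rcases (decode k : Option α) with _ | a <;> rcases (decode k : Option β) with _ | b
  · exact h
  · exact (h.swap.extend hw b).swap
  · exact h.extend hv a
  · exact ((h.extend hv a).swap.extend hw b).swap

/-- A form of **Myhill's isomorphism theorem**: predicates with avoiding reductions in both directions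
are computably isomorphic. -/
theorem exists_computable_bijective {P : α → Prop} {Q : β → Prop}
    (hPQ : AvoidReducible P Q) (hQP : AvoidReducible Q P) :
    ∃ e : α → β, Computable e ∧ Function.Bijective e ∧ ∀ a, P a ↔ Q (e a) := by
  obtain ⟨v, hvc, hv⟩ := hPQ
  obtain ⟨w, hwc, hw⟩ := hQP
  let S : ℕ → List (α × β) := fun n => Nat.rec [] (round v w) n
  have hS : Computable S := by
    have hstep : Computable₂ fun (_ : ℕ) (z : ℕ × List (α × β)) => round v w z.1 z.2 :=
      (computable_round hvc hwc).comp (Computable.fst.comp Computable.snd)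
        (Computable.snd.comp Computable.snd)
    exact Computable.nat_rec Computable.id (Computable.const []) hstep
  have hmatch : ∀ n, IsPartialMatch P Q (S n) := by
    intro n
    induction n with
    | zero => exact ⟨fun p hp => (by cases hp), fun p hp => (by cases hp)⟩
    | succ n ih => exact ih.round hv hw n
  have hmono : ∀ {m n}, m ≤ n → S m ⊆ S n := by
    intro m n hmn
    induction hmn with
    | refl => exact List.Subset.refl _
    | step _ ih => exact List.Subset.trans ih (subset_round v w _ _)
  have hpair : ∀ {m n p q}, p ∈ S m → q ∈ S n → (p.1 = q.1 ↔ p.2 = q.2) :=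
    fun {m n p q} hp hq => (hmatch (max m n)).2 p (hmono (le_max_left m n) hp) q
      (hmono (le_max_right m n) hq)
  have hleft : ∀ a, ∃ b, (a, b) ∈ S (encode a + 1) := fun a =>
    exists_mem_round_left v w a (S (encode a))
  have hright : ∀ b, ∃ a, (a, b) ∈ S (encode b + 1) := fun b =>
    exists_mem_round_right v w b (S (encode b))
  clear_value S
  choose e he using hleft
  refine ⟨e, ?_, ⟨fun a a' h => ?_, fun b => ?_⟩,
    fun a => (hmatch (encode a + 1)).1 (a, e a) (he a)⟩
  · have hSa : Computable fun a : α => S (encode a + 1) :=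
      hS.comp (Computable.succ.comp Computable.encode)
    have hlook : Computable fun a : α => ((S (encode a + 1)).map Prod.snd)[
        ((S (encode a + 1)).map Prod.fst).idxOf a]? :=
      Computable.list_getElem?.comp (primrec_map_snd.to_comp.comp hSa)
        (Primrec.list_idxOf.to_comp.comp Computable.id (primrec_map_fst.to_comp.comp hSa))
    -- The partner found at the first position of `a` is `e a`, because the stages are matches.
    refine (Computable.ofOption hlook).of_eq_tot fun a => ?_
    have hlt : ((S (encode a + 1)).map Prod.fst).idxOf a < (S (encode a + 1)).length := by
      have := List.idxOf_lt_length_iff.2 (List.mem_map_of_mem (f := Prod.fst) (he a))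
      simpa using this
    have hfst : ((S (encode a + 1))[((S (encode a + 1)).map Prod.fst).idxOf a]).1 = a := by
      have := List.getElem_idxOf (x := a) (xs := (S (encode a + 1)).map Prod.fst)
        (by simpa using hlt)
      rwa [List.getElem_map] at this
    have hsnd := (hpair (List.getElem_mem hlt) (he a)).1 hfst
    rw [Part.mem_coe, Option.mem_def, List.getElem?_map, List.getElem?_eq_getElem hlt,
      Option.map_some, hsnd]
  · exact (hpair (p := (a, e a)) (q := (a', e a')) (he a) (he a')).2 h
  · obtain ⟨a, ha⟩ := hright b
    exact ⟨a, (hpair (p := (a, e a)) (q := (a, b)) (he a) ha).1 rfl⟩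

end BackAndForth

/-! ### Reductions to and from the exit time set -/

theorem rePred_not_exitTime {t : α → ℕ → Bool} (ht : Computable₂ t) :
    REPred fun p => ¬ ExitTime t p := by
  let T : α × ℕ → ℕ → Bool := fun p n =>
    Nat.casesOn p.2 (t p.1 n) fun s => !(t p.1 (s + 1) && !t p.1 s)
  have hT : Computable₂ T := by
    have hx : Computable fun q : (α × ℕ) × ℕ => q.1.1 := Computable.fst.comp Computable.fst
    refine Computable.nat_casesOn (Computable.snd.comp Computable.fst)
      (ht.comp hx Computable.snd) ?_
    exact Primrec.not.to_comp.comp (Primrec.and.to_comp.comp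
      (ht.comp (hx.comp Computable.fst) (Computable.succ.comp Computable.snd))
      (Primrec.not.to_comp.comp (ht.comp (hx.comp Computable.fst) Computable.snd)))
  refine (rePred_exists hT).of_eq fun p => ?_
  rcases p with ⟨x, _ | s⟩
  · simp [T, ExitTime]
  · simp only [T, ExitTime]
    cases t x (s + 1) <;> cases t x s <;> simp

/-- The halting problem reduces to the complement of a coRE-complete set; codes are represented by
strings of the corresponding length. -/
theorem exists_halting_reduction {A : Set Str} (hA : IsCoREComplete A) :
    ∃ h : Code → Str, Computable h ∧ ∀ c, (Code.eval c 0).Dom ↔ h c ∉ A := by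
  let B : Set Str := {s | ¬ (Code.eval (Denumerable.ofNat Code s.length) 0).Dom}
  have hB : IsCoRE B := by
    have h := (Code.eval_part.comp ((Computable.ofNat Code).comp
      (Computable.list_length (α := Bool))) (Computable.const 0)).dom_re
    exact h.of_eq fun s => by simp [B]
  obtain ⟨g, hg, hgB⟩ := hA.2 B hB
  have hj : Computable fun c : Code => (List.range (encode c)).map fun _ => true :=
    (Primrec.list_map (Primrec.list_range.comp Primrec.encode)
      (Primrec.const true).to₂).to_comp
  refine ⟨fun c => g ((List.range (encode c)).map fun _ => true), hg.comp hj, fun c => ?_⟩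
  refine Iff.trans ?_ (not_congr (hgB _))
  simp [B]

theorem IsCoREComplete.isCompressible {A : Set Str} (hA : IsCoREComplete A) :
    IsCompressible FREC A := by
  obtain ⟨h, hc, hh⟩ := exists_halting_reduction hA
  obtain ⟨t, ht, h0, hmono, hAt⟩ := exists_stages_of_rePred hA.1
  have hA0 : ∀ x, x ∈ A ↔ ExitTime t (x, 0) := by
    intro x
    have := hAt x
    rw [Set.mem_compl_iff, not_iff_comm] at this
    rw [← this]
    simp [ExitTime]
  obtain ⟨v, hvc, hv⟩ := avoidReducible_of_halting (C := fun x => x ∉ A) hA.1 hc hh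
  obtain ⟨w, hwc, hw⟩ := avoidReducible_of_halting (C := fun x => x ∉ A)
    (rePred_not_exitTime ht) hc hh
  have hAE : AvoidReducible (fun x => x ∈ A) (ExitTime t) := by
    -- Padding `x` inside `A` is enough, as fresh first components give fresh pairs.
    refine ⟨fun x l => (v x (l.map Prod.fst), 0), ?_, fun x l => ⟨fun hm => ?_, ?_⟩⟩
    · exact (hvc.comp Computable.fst (primrec_map_fst.to_comp.comp Computable.snd)).pair
        (Computable.const 0)
    · exact (hv x _).1 (List.mem_map_of_mem (f := Prod.fst) hm)
    · rw [← hA0]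
      exact not_iff_not.1 (hv x (l.map Prod.fst)).2
  have hEA : AvoidReducible (ExitTime t) (fun x => x ∈ A) :=
    ⟨w, hwc, fun p l => ⟨(hw p l).1, not_iff_not.1 (hw p l).2⟩⟩
  obtain ⟨e, hec, ⟨hinj, hsurj⟩, he⟩ := exists_computable_bijective hAE hEA
  refine ⟨_, ⟨fun x => (e x).1, Computable.fst.comp hec, rfl⟩, fun _ _ => trivial, ?_, ?_⟩
  · refine Set.eq_univ_of_forall fun y => ?_
    obtain ⟨k, hk⟩ := exists_exitTime h0 y
    obtain ⟨a, ha⟩ := hsurj (y, k)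
    refine ⟨a, (he a).2 (ha ▸ hk), ?_⟩
    change y ∈ Part.some (e a).1
    simp [ha]
  · intro a ha b hb hab heq
    have h1 : (e a).1 = (e b).1 := by simpa using heq
    refine hab (hinj (Prod.ext h1 ?_))
    have hka := (he a).1 ha
    have hkb := (he b).1 hb
    rw [← Prod.mk.eta (p := e a)] at hka
    rw [← Prod.mk.eta (p := e b), ← h1] at hkb
    exact ExitTime.unique hmono hka hkb

end RecCompress

theorem mainTheorem4 (A : Set RecCompress.Str) (hA : RecCompress.IsCoREComplete A) :
    RecCompress.IsCompressible RecCompress.FREC A :=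
  hA.isCompressible
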